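/- Let $\mathcal H$ be a complex Hilbert space, let $n\ge 1$, and let $A_1,\dots,A_{2n+1}$ be strictly positive (i.e. positive and invertible) bounded operators on $\mathcal H$. Call $(t,p,r,m)$ *admissible* if $t_1,\dots,t_n\in[0,1]$, $p_1,\dots,p_{2n}\ge 1$, $r\ge t_n$, and $m\ge 2$ is an integer with $(r-t_n)m=\psi[2n]-t_n+r$, where $\psi[0]=1$ and $$\psi[2k]=(\psi[2k-2]\,p_{2k-1}-t_k)\,p_{2k}+t_k\qquad(1\le k\le n).$$ For strictly positive operators $B_1,\dots,B_{2n}$ define $N_1,\dots,N_n$ by $$N_1=\bigl(B_2^{-t_1/2}B_1^{p_1}B_2^{-t_1/2}\bigr)^{p_2},\qquad N_k=\Bigl[B_{2k}^{-t_k/2}\bigl\{B_{2k-1}^{t_{k-1}/2}N_{k-1}B_{2k-1}^{t_{k-1}/2}\bigr\}^{p_{2k-1}}B_{2k}^{-t_k/2}\Bigr]^{p_{2k}}\quad(2\le k\le n).$$ For $1\le i\le n$ let $D_i$ be $N_n$ built from $B_j=A_{\min(i+j-1,\,2n+1)}$; for $n+1\le i\le 2n$ let $D_i$ be $N_n$ built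 from $B_j=A_{\max(i+2-j,\,1)}$ $(1\le j\le 2n)$. Then the following three assertions are equivalent. (I) $A_{2n+1}\ge A_{2n}\ge\cdots\ge A_2\ge A_1$. (II) For all admissible $(t,p,r,m)$ the following $2n$ inequalities hold: $$(\mathrm{II}.i)\quad A_{2n+1}^{\,r-t_n}\ge\bigl\{A_{2n+1}^{r/2}D_iA_{2n+1}^{r/2}\bigr\}^{1/m}\ (1\le i\le n),\qquad A_1^{\,r-t_n}\le\bigl\{A_1^{r/2}D_iA_1^{r/2}\bigr\}^{1/m}\ (n+1\le i\le 2n).$$ (III) For all admissible $(t,p,r,m)$ and every $i=1,\dots,2n$ the following holds: $(\mathrm{III}.i)$ there is a unique strictly positive operator $S_i$ with $\|S_i\|\le 1$ satisfying $$X^{-t_n/2}T(X^{r-t_n}T)^{m-1}X^{-t_n/2}=X^{-t_n/2}(TX^{r-t_n})^{m-1}TX^{-t_n/2}=D_i,$$ where $X=A_{2n+1}$, $T=S_i$ if $1\le i\le n$, and $X=A_1$, $T=S_i^{-1}$ if $n+1\le i\le 2n$. Moreover, for each fixed admissible $(t,p,r,m)$ and each $i=1,\dots,2n$, assertion $(\mathrm{II}.i)$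 is equivalent to assertion $(\mathrm{III}.i)$. -/

import Mathlib

noncomputable section

namespace OperatorOrder

/-- `psi t p k` is the real number `ψ[2k]`; it only involves `t 1, …, t k` and `p 1, …, p (2k)`.
With the convention `ψ[0] = 1` the first step reads `ψ[2] = (p 1 - t 1) * p 2 + t 1`. -/
def psi (t p : ℕ → ℝ) : ℕ → ℝ
  | 0 => 1
  | k + 1 => (psi t p k * p (2 * k + 1) - t (k + 1)) * p (2 * k + 2) + t (k + 1)

/-- The real parameters `t 1, …, t n`, `p 1, …, p (2n)`, `r` and the integer `m` are admissible. -/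
structure Admissible (n : ℕ) (t p : ℕ → ℝ) (r : ℝ) (m : ℕ) : Prop where
  t_mem : ∀ j ∈ Finset.Icc 1 n, t j ∈ Set.Icc (0 : ℝ) 1
  one_le_p : ∀ j ∈ Finset.Icc 1 (2 * n), 1 ≤ p j
  t_le_r : t n ≤ r
  two_le_m : 2 ≤ m
  exponent_eq : (r - t n) * (m : ℝ) = psi t p n - t n + r

variable {H : Type*} [NormedAddCommGroup H] [InnerProductSpace ℂ H] [CompleteSpace H]

/-- The nested bracket with outermost exponent `p (2k)`, built on operators `B 1, …, B (2k)`: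
`[B₂ₖ^(-tₖ/2) {B₂ₖ₋₁^(tₖ₋₁/2) ⋯ (B₂^(-t₁/2) B₁^(p₁) B₂^(-t₁/2))^(p₂) ⋯ B₂ₖ₋₁^(tₖ₋₁/2)}^(p₂ₖ₋₁)
B₂ₖ^(-tₖ/2)]^(p₂ₖ)`. All exponents are real and all powers are taken in the continuous functional
calculus. The value at `k = 0` is irrelevant. -/
def nested (B : ℕ → H →L[ℂ] H) (t p : ℕ → ℝ) : ℕ → H →L[ℂ] H
  | 0 => 1
  | 1 => (B 2 ^ (-(t 1) / 2) * B 1 ^ p 1 * B 2 ^ (-(t 1) / 2)) ^ p 2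
  | k + 2 =>
      (B (2 * k + 4) ^ (-(t (k + 2)) / 2) *
          (B (2 * k + 3) ^ (t (k + 1) / 2) * nested B t p (k + 1) *
            B (2 * k + 3) ^ (t (k + 1) / 2)) ^ p (2 * k + 3) *
        B (2 * k + 4) ^ (-(t (k + 2)) / 2)) ^ p (2 * k + 4)

/-- For `1 ≤ i ≤ n`, the operators `A i, A (i + 1), A (i + 2), …`, the index being replaced by
`2n + 1` once it would exceed `2n + 1`; numbered from `1`. -/
def upSeq (A : ℕ → H →L[ℂ] H) (n i : ℕ) : ℕ → H →L[ℂ] H :=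
  fun j => A (min (i + j - 1) (2 * n + 1))

/-- For `n + 1 ≤ i ≤ 2n`, the operators `A (i + 1), A i, A (i - 1), …`, the index being replaced
by `1` once it would fall below `1`; numbered from `1`. -/
def downSeq (A : ℕ → H →L[ℂ] H) (i : ℕ) : ℕ → H →L[ℂ] H :=
  fun j => A (max (i + 2 - j) 1)

/-- The `i`-th operator inequality, `1 ≤ i ≤ 2n`. -/
def Inequality (A : ℕ → H →L[ℂ] H) (n : ℕ) (t p : ℕ → ℝ) (r : ℝ) (m i : ℕ) : Prop :=
  if i ≤ n then
    A (2 * n + 1) ^ (r - t n) ≥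
      (A (2 * n + 1) ^ (r / 2) * nested (upSeq A n i) t p n * A (2 * n + 1) ^ (r / 2)) ^
        (1 / (m : ℝ))
  else
    A 1 ^ (r - t n) ≤
      (A 1 ^ (r / 2) * nested (downSeq A i) t p n * A 1 ^ (r / 2)) ^ (1 / (m : ℝ))

/-- `X^(-s/2) T (X^(r-s) T)^(m-1) X^(-s/2) = X^(-s/2) (T X^(r-s))^(m-1) T X^(-s/2) = N`. -/
def DoubleEquality (X T N : H →L[ℂ] H) (s r : ℝ) (m : ℕ) : Prop :=
  X ^ (-s / 2) * T * (X ^ (r - s) * T) ^ (m - 1) * X ^ (-s / 2) =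
      X ^ (-s / 2) * (T * X ^ (r - s)) ^ (m - 1) * T * X ^ (-s / 2) ∧
    X ^ (-s / 2) * (T * X ^ (r - s)) ^ (m - 1) * T * X ^ (-s / 2) = N

/-- `S` satisfies the `i`-th chain of operator equalities, `1 ≤ i ≤ 2n`: it involves `S` for
`i ≤ n` and the inverse of `S` for `i > n`. -/
def Equality (A : ℕ → H →L[ℂ] H) (n : ℕ) (t p : ℕ → ℝ) (r : ℝ) (m i : ℕ)
    (S : H →L[ℂ] H) : Prop :=
  if i ≤ n then
    DoubleEquality (A (2 * n + 1)) S (nested (upSeq A n i) t p n) (t n) r m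
  else
    DoubleEquality (A 1) (Ring.inverse S) (nested (downSeq A i) t p n) (t n) r m

/-- There is exactly one strictly positive `S` of norm at most one that satisfies the `i`-th chain
of operator equalities. -/
def UniqueSolution (A : ℕ → H →L[ℂ] H) (n : ℕ) (t p : ℕ → ℝ) (r : ℝ) (m i : ℕ) : Prop :=
  ∃! S : H →L[ℂ] H, IsStrictlyPositive S ∧ ‖S‖ ≤ 1 ∧ Equality A n t p r m i S

end OperatorOrder

end

noncomputable section

namespace OperatorOrder

/-! ### Real powers and conjugation by powers in a C*-algebra. -/

section CStar

variable {𝒜 : Type*} [CStarAlgebra 𝒜] [PartialOrder 𝒜] [StarOrderedRing 𝒜]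

/-! Chain to inequalities: `geoPath` is monotone in its left end for exponents in `[0, 1]` and
antitone in `[1, 2]`. Doubling arguments remove the bounds on the exponents, giving
`grand_furuta_three` and `furuta`. The former, iterated over the nesting, gives `nested_rpow_le`;
the latter raises the outer exponent from `t n` to `r`. Decreasing sequences are handled by
inverting all operators.

Inequalities to chain: take all `t j = 1` and all `p j = 1` except `p 2 = 2 ^ q`. The bracket is
then `W * M ^ (2 ^ q) * star W`, with `W` independent of `q` and `M` the conjugate of `B 1` by `B 2
^ (-1 / 2)`. The inequality bounds `‖M ^ (2 ^ q)‖` uniformly in `q`, so `M ≤ 1`, that is `B 1 ≤ B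
2`.

Inequalities and equations: the equation prescribes the `m`-th power of `conjPow X ((r - s) / 2) T`,
so uniqueness of positive roots determines `T`, and the norm bound is the inequality
(`doubleEquality_iff`). -/

lemma sp_rpow {a : 𝒜} (ha : IsStrictlyPositive a) (x : ℝ) : IsStrictlyPositive (a ^ x) :=
  IsStrictlyPositive.rpow a x ha

lemma rpow_mul_rpow {a : 𝒜} (ha : IsStrictlyPositive a) (x y : ℝ) :
    a ^ x * a ^ y = a ^ (x + y) := (CFC.rpow_add ha.isUnit).symm

lemma rpow_rpow_of_sp {a : 𝒜} (ha : IsStrictlyPositive a) (x y : ℝ) :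
    (a ^ x) ^ y = a ^ (x * y) := by
  by_cases hx : x = 0
  · subst hx
    rw [zero_mul, CFC.rpow_zero a ha.nonneg, CFC.one_rpow]
  · exact CFC.rpow_rpow a x y hx ha

lemma rpow_zero_of_sp {a : 𝒜} (ha : IsStrictlyPositive a) : a ^ (0 : ℝ) = 1 :=
  CFC.rpow_zero a ha.nonneg

lemma rpow_one_of_sp {a : 𝒜} (ha : IsStrictlyPositive a) : a ^ (1 : ℝ) = a :=
  CFC.rpow_one a ha.nonneg

lemma rpow_rpow_cancel {a : 𝒜} (ha : IsStrictlyPositive a) {x y : ℝ} (h : x * y = 1) :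
    (a ^ x) ^ y = a := by
  rw [rpow_rpow_of_sp ha, h, rpow_one_of_sp ha]

/-- Conjugation of `b` by the power `a ^ x`. -/
def conjPow (a : 𝒜) (x : ℝ) (b : 𝒜) : 𝒜 := a ^ x * b * a ^ x

lemma sp_conjPow {a b : 𝒜} (ha : IsStrictlyPositive a) (x : ℝ) (hb : IsStrictlyPositive b) :
    IsStrictlyPositive (conjPow a x b) :=
  IsStrictlyPositive.conjugate_of_isUnit_of_isSelfAdjoint b (a ^ x) (sp_rpow ha x).isUnit
    (sp_rpow ha x).isSelfAdjoint hb

lemma conjPow_le_conjPow (a : 𝒜) (x : ℝ) {b c : 𝒜} (h : b ≤ c) :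
    conjPow a x b ≤ conjPow a x c :=
  conjugate_le_conjugate_of_nonneg h CFC.rpow_nonneg

lemma conjPow_conjPow {a : 𝒜} (ha : IsStrictlyPositive a) (x y : ℝ) (b : 𝒜) :
    conjPow a x (conjPow a y b) = conjPow a (x + y) b := by
  calc conjPow a x (conjPow a y b) = (a ^ x * a ^ y) * b * (a ^ y * a ^ x) := by
        simp only [conjPow, mul_assoc]
    _ = conjPow a (x + y) b := by
        rw [rpow_mul_rpow ha, rpow_mul_rpow ha, add_comm y x]; rfl

lemma conjPow_zero {a : 𝒜} (ha : IsStrictlyPositive a) (b : 𝒜) : conjPow a 0 b = b := by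
  simp [conjPow, rpow_zero_of_sp ha]

lemma conjPow_cancel {a : 𝒜} (ha : IsStrictlyPositive a) {x y : ℝ} (h : x + y = 0) (b : 𝒜) :
    conjPow a x (conjPow a y b) = b := by
  rw [conjPow_conjPow ha, h, conjPow_zero ha]

lemma conjPow_rpow {a : 𝒜} (ha : IsStrictlyPositive a) (x y : ℝ) :
    conjPow a x (a ^ y) = a ^ (2 * x + y) := by
  rw [conjPow, rpow_mul_rpow ha, rpow_mul_rpow ha]; congr 1; ring

lemma conjPow_rpow_base {a : 𝒜} (ha : IsStrictlyPositive a) (x y : ℝ) (b : 𝒜) :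
    conjPow (a ^ x) y b = conjPow a (x * y) b := by
  rw [conjPow, rpow_rpow_of_sp ha]; rfl

lemma conjPow_le_iff {a : 𝒜} (ha : IsStrictlyPositive a) (x : ℝ) {b c : 𝒜} :
    conjPow a x b ≤ c ↔ b ≤ conjPow a (-x) c := by
  constructor
  · intro h
    simpa [conjPow_cancel ha (neg_add_cancel x)] using conjPow_le_conjPow a (-x) h
  · intro h
    simpa [conjPow_cancel ha (add_neg_cancel x)] using conjPow_le_conjPow a x h

lemma rpow_neg_one_of_mul {y z : 𝒜} (hy : IsStrictlyPositive y) (h : y * z = 1) :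
    y ^ (-1 : ℝ) = z := by
  have h1 : y ^ (-1 : ℝ) * y = 1 := by
    conv_lhs => rw [← rpow_one_of_sp hy]
    rw [rpow_rpow_of_sp hy, rpow_mul_rpow hy]
    norm_num
    exact rpow_zero_of_sp hy
  calc y ^ (-1 : ℝ) = y ^ (-1 : ℝ) * (y * z) := by rw [h, mul_one]
    _ = z := by rw [← mul_assoc, h1, one_mul]

lemma conjPow_rpow_neg_one {a b : 𝒜} (ha : IsStrictlyPositive a) (x : ℝ)
    (hb : IsStrictlyPositive b) :
    (conjPow a x b) ^ (-1 : ℝ) = conjPow a (-x) (b ^ (-1 : ℝ)) := by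
  apply rpow_neg_one_of_mul (sp_conjPow ha x hb)
  have hb1 : b * b ^ (-1 : ℝ) = 1 := by
    nth_rw 1 [← rpow_one_of_sp hb]
    exact CFC.rpow_mul_rpow_neg 1 hb
  calc conjPow a x b * conjPow a (-x) (b ^ (-1 : ℝ))
      = a ^ x * b * (a ^ x * a ^ (-x)) * b ^ (-1 : ℝ) * a ^ (-x) := by
        simp only [conjPow, mul_assoc]
    _ = a ^ x * (b * b ^ (-1 : ℝ)) * a ^ (-x) := by
        rw [CFC.rpow_mul_rpow_neg x ha]; simp only [mul_one, mul_assoc]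
    _ = 1 := by rw [hb1, mul_one, CFC.rpow_mul_rpow_neg x ha]

lemma rpow_neg_one_le {a b : 𝒜} (ha : IsStrictlyPositive a) (h : a ≤ b) :
    b ^ (-1 : ℝ) ≤ a ^ (-1 : ℝ) := CStarAlgebra.rpow_neg_one_le_rpow_neg_one h ha

lemma le_of_rpow_neg_one_le {a b : 𝒜} (ha : IsStrictlyPositive a) (hb : IsStrictlyPositive b)
    (h : b ^ (-1 : ℝ) ≤ a ^ (-1 : ℝ)) : a ≤ b := by
  have := rpow_neg_one_le (sp_rpow hb _) h
  rwa [rpow_rpow_cancel ha (by norm_num), rpow_rpow_cancel hb (by norm_num)] at this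

/-- Inversion reverses the order; Löwner–Heinz with exponent `-q` does the rest. -/
lemma rpow_antitone_of_nonpos {a b : 𝒜} (ha : IsStrictlyPositive a) (h : a ≤ b) {q : ℝ}
    (hq : -1 ≤ q) (hq' : q ≤ 0) : b ^ q ≤ a ^ q := by
  have hb := ha.of_le h
  have := CFC.rpow_le_rpow (p := -q) ⟨by linarith, by linarith⟩ (rpow_neg_one_le ha h)
  rwa [rpow_rpow_of_sp ha, rpow_rpow_of_sp hb, show (-1 : ℝ) * -q = q by ring] at this

lemma rpow_mono {a b : 𝒜} (h : a ≤ b) {q : ℝ} (hq : 0 ≤ q) (hq' : q ≤ 1) : a ^ q ≤ b ^ q :=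
  CFC.rpow_le_rpow ⟨hq, hq'⟩ h

/-! ### Furuta's lemma and the geometric path. -/

lemma unitary_conj_rpow {a u : 𝒜} (ha : IsStrictlyPositive a) (hu : u ∈ unitary 𝒜) (s : ℝ) :
    (u * a * star u) ^ s = u * a ^ s * star u := by
  have hu1 : IsUnit u := ⟨Unitary.toUnits ⟨u, hu⟩, rfl⟩
  have hb : IsStrictlyPositive (u * a * star u) :=
    (hu1.isStrictlyPositive_star_right_conjugate_iff).2 ha
  rw [CFC.rpow_eq_cfc_real (a := a) ha.nonneg, CFC.rpow_eq_cfc_real hb.nonneg]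
  have hcont : ContinuousOn (fun x : ℝ => x ^ s) (spectrum ℝ a) := fun x hx =>
    (Real.continuousAt_rpow_const x s
      (Or.inl (ha.spectrum_pos hx).ne')).continuousWithinAt
  have hφ : Continuous (Unitary.conjStarAlgAut ℝ 𝒜 ⟨u, hu⟩) := by
    have : (Unitary.conjStarAlgAut ℝ 𝒜 ⟨u, hu⟩ : 𝒜 → 𝒜) = fun x => u * x * star u := by
      ext x; simp
    rw [this]; fun_prop
  have := StarAlgHomClass.map_cfc (S := ℝ) (Unitary.conjStarAlgAut ℝ 𝒜 ⟨u, hu⟩)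
    (fun x : ℝ => x ^ s) a hcont hφ ha.isSelfAdjoint
    (by simpa using hb.isSelfAdjoint)
  simpa using this.symm

/-- Furuta's lemma: `(x x*)^s = x (x* x)^(s-1) x*` for invertible `x`. -/
lemma mul_star_rpow {x : 𝒜} (hx : IsUnit x) (s : ℝ) :
    (x * star x) ^ s = x * (star x * x) ^ (s - 1) * star x := by
  set c := star x * x with hc
  have hcp : IsStrictlyPositive c := by
    have := (hx.isStrictlyPositive_star_left_conjugate_iff (a := (1 : 𝒜))).2
      isStrictlyPositive_one
    simpa using this
  -- Polar decomposition: `u` is the unitary part of `x`, and it carries `star x * x` to `x * star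
  -- x`.
  set u := x * c ^ (-1 / 2 : ℝ) with hu
  have hcs : star (c ^ (-1 / 2 : ℝ)) = c ^ (-1 / 2 : ℝ) := (sp_rpow hcp _).isSelfAdjoint
  have hus : star u = c ^ (-1 / 2 : ℝ) * star x := by rw [hu, star_mul, hcs]
  have h1 : star u * u = 1 := by
    calc star u * u = c ^ (-1 / 2 : ℝ) * c * c ^ (-1 / 2 : ℝ) := by
          rw [hus, hu, hc]; simp only [mul_assoc]
      _ = conjPow c (-1 / 2) (c ^ (1 : ℝ)) := by rw [rpow_one_of_sp hcp]; rfl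
      _ = 1 := by rw [conjPow_rpow hcp]; norm_num; exact rpow_zero_of_sp hcp
  have huu : IsUnit u := hx.mul (sp_rpow hcp _).isUnit
  have h2 : u * star u = 1 := by
    obtain ⟨v, hv⟩ := huu
    have : star u = ↑v⁻¹ := by
      rw [← hv] at h1 ⊢
      exact (Units.inv_eq_of_mul_eq_one_left h1).symm
    rw [this, ← hv]; simp
  have hmem : u ∈ unitary 𝒜 := Unitary.mem_iff.2 ⟨h1, h2⟩
  have key (q : ℝ) : u * c ^ q * star u = x * c ^ (q - 1) * star x := by
    calc u * c ^ q * star u = x * conjPow c (-1 / 2) (c ^ q) * star x := by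
          rw [hus, hu, conjPow]; simp only [mul_assoc]
      _ = _ := by rw [conjPow_rpow hcp]; congr 3; ring
  have h3 : x * star x = u * c * star u := by
    have := key 1
    rw [rpow_one_of_sp hcp, sub_self, rpow_zero_of_sp hcp, mul_one] at this
    exact this.symm
  rw [h3, unitary_conj_rpow hcp hmem, key]

/-- The path `a^(1/2) (a^(-1/2) b a^(-1/2))^s a^(1/2)` through `a` at `s = 0` and `b` at `s = 1`;
for `s ∈ [0, 1]` it is the weighted geometric mean. -/
def geoPath (a b : 𝒜) (s : ℝ) : 𝒜 := conjPow a (1 / 2) (conjPow a (-1 / 2) b ^ s)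

lemma sp_geoPath {a b : 𝒜} (ha : IsStrictlyPositive a) (hb : IsStrictlyPositive b) (s : ℝ) :
    IsStrictlyPositive (geoPath a b s) :=
  sp_conjPow ha _ (sp_rpow (sp_conjPow ha _ hb) _)

/-- Furuta's lemma for `x = a ^ (-1/2) * b ^ (1/2)`: the base of one path is `x * star x`, that of
the other is the inverse of `star x * x`. -/
lemma geoPath_symm {a b : 𝒜} (ha : IsStrictlyPositive a) (hb : IsStrictlyPositive b) (s : ℝ) :
    geoPath a b s = geoPath b a (1 - s) := by
  set x := a ^ (-1 / 2 : ℝ) * b ^ (1 / 2 : ℝ) with hx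
  have hxu : IsUnit x := (sp_rpow ha _).isUnit.mul (sp_rpow hb _).isUnit
  have hxs : star x = b ^ (1 / 2 : ℝ) * a ^ (-1 / 2 : ℝ) := by
    rw [hx, star_mul, (sp_rpow ha _).isSelfAdjoint.star_eq, (sp_rpow hb _).isSelfAdjoint.star_eq]
  have hbb : b ^ (1 / 2 : ℝ) * b ^ (1 / 2 : ℝ) = b := by
    rw [rpow_mul_rpow hb]; norm_num; exact rpow_one_of_sp hb
  have haa : a ^ (-1 / 2 : ℝ) * a ^ (-1 / 2 : ℝ) = a ^ (-1 : ℝ) := by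
    rw [rpow_mul_rpow ha]; norm_num
  have h1 : conjPow a (-1 / 2) b = x * star x := by
    rw [hxs, hx, conjPow]; nth_rw 1 [← hbb]; simp only [mul_assoc]
  have h2 : star x * x = conjPow b (-1 / 2) a ^ (-1 : ℝ) := by
    rw [conjPow_rpow_neg_one hb _ ha, hxs, hx, conjPow, ← haa,
      show (-(-1 / 2) : ℝ) = 1 / 2 by norm_num]
    simp only [mul_assoc]
  have h3 : a ^ (1 / 2 : ℝ) * x = b ^ (1 / 2 : ℝ) := by
    rw [hx, ← mul_assoc, rpow_mul_rpow ha]; norm_num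
    rw [rpow_zero_of_sp ha, one_mul]
  have h4 : star x * a ^ (1 / 2 : ℝ) = b ^ (1 / 2 : ℝ) := by
    rw [hxs, mul_assoc, rpow_mul_rpow ha]; norm_num
    rw [rpow_zero_of_sp ha, mul_one]
  rw [geoPath, h1, mul_star_rpow hxu, h2, rpow_rpow_of_sp (sp_conjPow hb _ ha), geoPath,
    show (-1 : ℝ) * (s - 1) = 1 - s by ring, conjPow, conjPow]
  calc a ^ (1 / 2 : ℝ) * (x * conjPow b (-1 / 2) a ^ (1 - s) * star x) * a ^ (1 / 2 : ℝ)
      = (a ^ (1 / 2 : ℝ) * x) * conjPow b (-1 / 2) a ^ (1 - s) * (star x * a ^ (1 / 2 : ℝ)) := by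
        simp only [mul_assoc]
    _ = _ := by rw [h3, h4]; rfl

lemma geoPath_mono_right (a : 𝒜) {b c : 𝒜} (h : b ≤ c) {s : ℝ} (hs : 0 ≤ s) (hs' : s ≤ 1) :
    geoPath a b s ≤ geoPath a c s :=
  conjPow_le_conjPow _ _ (rpow_mono (conjPow_le_conjPow _ _ h) hs hs')

lemma geoPath_mono_left {a b c : 𝒜} (ha : IsStrictlyPositive a) (hc : IsStrictlyPositive c)
    (h : a ≤ b) {s : ℝ} (hs : 0 ≤ s) (hs' : s ≤ 1) : geoPath a c s ≤ geoPath b c s := by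
  rw [geoPath_symm ha hc, geoPath_symm (ha.of_le h) hc]
  exact geoPath_mono_right _ h (by linarith) (by linarith)

/-- After swapping the ends the exponent `1 - s` lies in `[-1, 0]`, where powers reverse the order.
-/
lemma geoPath_anti_left {a b c : 𝒜} (ha : IsStrictlyPositive a) (hc : IsStrictlyPositive c)
    (h : a ≤ b) {s : ℝ} (hs : 1 ≤ s) (hs' : s ≤ 2) : geoPath b c s ≤ geoPath a c s := by
  rw [geoPath_symm ha hc, geoPath_symm (ha.of_le h) hc]
  exact conjPow_le_conjPow _ _ (rpow_antitone_of_nonpos (sp_conjPow hc _ ha)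
    (conjPow_le_conjPow _ _ h) (by linarith) (by linarith))

lemma geoPath_rpow_left {c : 𝒜} (hc : IsStrictlyPositive c) (x : ℝ) (b : 𝒜) (s : ℝ) :
    geoPath (c ^ x) b s = conjPow c (x / 2) (conjPow c (-x / 2) b ^ s) := by
  rw [geoPath, conjPow_rpow_base hc, conjPow_rpow_base hc]
  congr 3 <;> ring

lemma geoPath_rpow_rpow {c : 𝒜} (hc : IsStrictlyPositive c) (x y s : ℝ) :
    geoPath (c ^ x) (c ^ y) s = c ^ (x + s * (y - x)) := by
  rw [geoPath_rpow_left hc, conjPow_rpow hc, rpow_rpow_of_sp hc, conjPow_rpow hc]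
  congr 1; ring

lemma geoPath_geoPath {a b : 𝒜} (ha : IsStrictlyPositive a) (hb : IsStrictlyPositive b)
    (s u : ℝ) : geoPath a (geoPath a b s) u = geoPath a b (s * u) := by
  rw [geoPath, geoPath, conjPow_cancel ha (by norm_num), rpow_rpow_of_sp (sp_conjPow ha _ hb),
    geoPath]

/-! ### Inequalities of Furuta type. -/

/-- The case `r = t` of the grand Furuta inequality, with the smaller operator as a bound. -/
lemma grand_furuta_le_left {t : ℝ} (ht : 0 ≤ t) (ht' : t ≤ 1) {b : 𝒜} (N : ℕ) :
    ∀ {y : 𝒜} {p s : ℝ}, IsStrictlyPositive y → y ≤ b → 1 ≤ p → 1 ≤ s → s ≤ 2 ^ N →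
      geoPath (b ^ t) (y ^ p) s ^ (1 / ((p - t) * s + t)) ≤ y := by
  have base {y : 𝒜} {p s : ℝ} (hy : IsStrictlyPositive y) (h : y ≤ b) (hp : 1 ≤ p) (hs : 1 ≤ s)
      (hs' : s ≤ 2) : geoPath (b ^ t) (y ^ p) s ^ (1 / ((p - t) * s + t)) ≤ y := by
    have hβ : 1 ≤ (p - t) * s + t := by nlinarith
    -- Replacing `b` by `y` makes the path a pure power `y ^ ((p - t) * s + t)`, whose root is `y`.
    have h1 := geoPath_anti_left (sp_rpow hy t) (sp_rpow hy p) (rpow_mono h ht ht') hs hs'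
    rw [geoPath_rpow_rpow hy] at h1
    refine (rpow_mono h1 (q := 1 / ((p - t) * s + t)) (by positivity)
      (by rw [div_le_one (by linarith)]; exact hβ)).trans_eq ?_
    apply rpow_rpow_cancel hy
    rw [show t + s * (p - t) = (p - t) * s + t by ring]
    field_simp
  induction N with
  | zero => exact fun hy h hp hs hs' => base hy h hp hs (by norm_num at hs'; linarith)
  | succ N ih =>
    intro y p s hy h hp hs hs'
    by_cases h2 : s ≤ 2
    · exact base hy h hp hs h2
    push Not at h2
    have hb := hy.of_le h
    have h1 := base hy h hp one_le_two le_rfl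
    set β := (p - t) * 2 + t with hβ
    have hβ1 : 1 ≤ β := by nlinarith
    have hsp := sp_geoPath (sp_rpow hb t) (sp_rpow hy p) 2
    -- The exponent-2 case gives a new operator below `y`; with `β` for `p` and `s / 2` for `s`, its
    -- path is the original one, since nested paths multiply exponents.
    have h3 := ih (y := geoPath (b ^ t) (y ^ p) 2 ^ (1 / β)) (p := β) (s := s / 2)
      (sp_rpow hsp _) (h1.trans h) hβ1 (by linarith) (by rw [pow_succ] at hs'; linarith)
    rw [rpow_rpow_cancel hsp (by field_simp), geoPath_geoPath (sp_rpow hb t) (sp_rpow hy p),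
      show 2 * (s / 2) = s by ring, hβ,
      show ((p - t) * 2 + t - t) * (s / 2) + t = (p - t) * s + t by ring] at h3
    exact h3.trans h1

/-- Three operators `y ≤ b ≤ c` in the grand Furuta inequality with `r = t`. -/
lemma grand_furuta_three {t p s : ℝ} (ht : 0 ≤ t) (ht' : t ≤ 1) (hp : 1 ≤ p) (hs : 1 ≤ s)
    {y b c : 𝒜} (hy : IsStrictlyPositive y) (hyb : y ≤ b) (hbc : b ≤ c) :
    conjPow c (t / 2) (conjPow b (-t / 2) (y ^ p) ^ s) ^ (1 / ((p - t) * s + t)) ≤ c := by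
  have hb := hy.of_le hyb
  have hc := hb.of_le hbc
  obtain ⟨N, hN⟩ := pow_unbounded_of_one_lt s one_lt_two
  have h1 := grand_furuta_le_left ht ht' N hy hyb hp hs hN.le
  have hβ : 1 ≤ (p - t) * s + t := by nlinarith
  set β := (p - t) * s + t
  set m := conjPow b (-t / 2) (y ^ p) ^ s with hm
  have hmp : IsStrictlyPositive m := sp_rpow (sp_conjPow hb _ (sp_rpow hy p)) _
  rw [geoPath_rpow_left hb, ← hm] at h1
  have hanti : c ^ (-t) ≤ b ^ (-t) :=
    rpow_antitone_of_nonpos hb hbc (by linarith) (by linarith)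
  -- Paths towards the common end `m` turn the outer conjugation by `b` into one by `c`.
  have h2 := geoPath_mono_left (sp_rpow hc _) hmp hanti (s := 1 / β) (by positivity)
    (by rw [div_le_one (by linarith)]; exact hβ)
  rw [geoPath_rpow_left hc, geoPath_rpow_left hb, neg_neg] at h2
  have h3 : conjPow b (-t / 2) b ≤ conjPow c (-t / 2) c := by
    have e (d : 𝒜) (hd : IsStrictlyPositive d) : conjPow d (-t / 2) d = d ^ (1 - t) := by
      nth_rw 2 [← rpow_one_of_sp hd]
      rw [conjPow_rpow hd]; congr 1; ring
    rw [e b hb, e c hc]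
    exact rpow_mono hbc (by linarith) (by linarith)
  have h4 := h2.trans ((conjPow_le_conjPow b (-t / 2) (h1.trans hyb)).trans h3)
  rw [conjPow_le_iff hc, conjPow_cancel hc (by ring)] at h4
  exact h4

/-- The Furuta inequality. -/
lemma furuta (N : ℕ) : ∀ {z c : 𝒜} {p r : ℝ}, IsStrictlyPositive z → z ≤ c → 1 ≤ p → 0 ≤ r →
    1 + r ≤ 2 ^ N → conjPow c (r / 2) (z ^ p) ^ ((1 + r) / (p + r)) ≤ c ^ (1 + r) := by
  have base {z c : 𝒜} {p r : ℝ} (hz : IsStrictlyPositive z) (h : z ≤ c) (hp : 1 ≤ p)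
      (hr : 0 ≤ r) (hr' : r ≤ 1) :
      conjPow c (r / 2) (z ^ p) ^ ((1 + r) / (p + r)) ≤ c ^ (1 + r) := by
    have hc := hz.of_le h
    have hpr : 0 < p + r := by linarith
    -- The path from `z ^ (-r)` to `z ^ p` at this parameter is `z`.
    have h1 := geoPath_mono_left (sp_rpow hc (-r)) (sp_rpow hz p)
      (rpow_antitone_of_nonpos hz h (by linarith) (by linarith)) (s := (1 + r) / (p + r))
      (by positivity) (by rw [div_le_one hpr]; linarith)
    rw [geoPath_rpow_rpow hz, show -r + (1 + r) / (p + r) * (p - -r) = 1 by field_simp; ring,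
      rpow_one_of_sp hz, geoPath_rpow_left hc, neg_neg] at h1
    have h2 := h1.trans h
    rw [conjPow_le_iff hc] at h2
    refine h2.trans_eq ?_
    nth_rw 2 [← rpow_one_of_sp hc]
    rw [conjPow_rpow hc]; congr 1; ring
  induction N with
  | zero => exact fun hz h hp hr hr' => base hz h hp hr (by norm_num at hr'; linarith)
  | succ N ih =>
    intro z c p r hz h hp hr hr'
    by_cases h1 : r ≤ 1
    · exact base hz h hp hr h1
    push Not at h1
    have hc := hz.of_le h
    -- Chosen so that the case `r = 1`, applied to the inequality already known for `r₀`, yields `2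
    -- * r₀ + 1`; also `1 + r₀` is half of `1 + r`, which fits the induction.
    obtain ⟨r₀, hr₀⟩ : ∃ r₀, r₀ = (r - 1) / 2 := ⟨_, rfl⟩
    obtain rfl : r = 2 * r₀ + 1 := by linarith
    have hr0 : 0 ≤ r₀ := by linarith
    have hpr : 0 < p + r₀ := by linarith
    have h2 := ih hz h hp hr0 (by rw [pow_succ] at hr'; linarith)
    have hsp := sp_conjPow hc (r₀ / 2) (sp_rpow hz p)
    have h3 := base (p := (p + r₀) / (1 + r₀)) (sp_rpow hsp _) h2
      (by rw [le_div_iff₀ (by linarith)]; linarith) zero_le_one le_rfl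
    rw [rpow_rpow_cancel hsp (by field_simp), conjPow_rpow_base hc, conjPow_conjPow hc,
      rpow_rpow_of_sp hc] at h3
    convert h3 using 2
    · congr 1; ring
    · field_simp; ring
    · ring

lemma furuta_chaotic {z c : 𝒜} {p u : ℝ} (hz : IsStrictlyPositive z) (h : z ≤ c) (hp : 1 ≤ p)
    (hu : 0 ≤ u) : conjPow c (u / 2) (z ^ p) ^ (u / (p + u)) ≤ c ^ u := by
  have hc := hz.of_le h
  obtain ⟨N, hN⟩ := pow_unbounded_of_one_lt (1 + u) one_lt_two
  have h1 := rpow_mono (furuta N hz h hp hu hN.le) (q := u / (1 + u)) (by positivity)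
    (by rw [div_le_one (by linarith)]; linarith)
  rw [rpow_rpow_of_sp hc, rpow_rpow_of_sp (sp_conjPow hc _ (sp_rpow hz p))] at h1
  have hpu : 0 < p + u := by linarith
  convert h1 using 2 <;> field_simp

/-! ### Inverses, integer powers and contractions. -/

lemma rpow_neg_one_rpow {a : 𝒜} (ha : IsStrictlyPositive a) (x : ℝ) :
    (a ^ (-1 : ℝ)) ^ x = (a ^ x) ^ (-1 : ℝ) := by
  rw [rpow_rpow_of_sp ha, rpow_rpow_of_sp ha, mul_comm]

lemma conjPow_inv {a b : 𝒜} (ha : IsStrictlyPositive a) (x : ℝ) (hb : IsStrictlyPositive b) :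
    conjPow (a ^ (-1 : ℝ)) x (b ^ (-1 : ℝ)) = conjPow a x b ^ (-1 : ℝ) := by
  rw [conjPow_rpow_neg_one ha x hb, conjPow_rpow_base ha, neg_one_mul]

lemma conjPow_pow_succ {x : 𝒜} (hx : IsStrictlyPositive x) (a : ℝ) (T : 𝒜) (k : ℕ) :
    conjPow x a T ^ (k + 1) = conjPow x a ((T * x ^ (2 * a)) ^ k * T) := by
  induction k with
  | zero => simp
  | succ k ih =>
    rw [pow_succ, ih, conjPow, conjPow, conjPow, pow_succ, two_mul, ← rpow_mul_rpow hx]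
    simp only [mul_assoc]

lemma pow_eq_iff_eq_rpow {y z : 𝒜} (hz : IsStrictlyPositive z) (hy : IsStrictlyPositive y) {m : ℕ}
    (hm : m ≠ 0) : z ^ m = y ↔ z = y ^ (1 / (m : ℝ)) := by
  have hm' : (m : ℝ) ≠ 0 := Nat.cast_ne_zero.2 hm
  rw [← CFC.rpow_natCast z m hz.nonneg]
  constructor
  · rintro rfl
    exact (rpow_rpow_cancel hz (by field_simp)).symm
  · rintro rfl
    exact rpow_rpow_cancel hy (by field_simp)

/-- By the C*-identity `‖M ^ (2 ^ q)‖ = ‖M‖ ^ (2 ^ q)`, which is unbounded if `‖M‖ > 1`. -/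
lemma le_one_of_forall_norm_pow_le {M : 𝒜} (hM : IsStrictlyPositive M) {K : ℝ}
    (h : ∀ q : ℕ, ‖M ^ (2 ^ q)‖ ≤ K) : M ≤ 1 := by
  rw [← CStarAlgebra.norm_le_one_iff_of_nonneg M hM.nonneg]
  by_contra! hlt
  obtain ⟨N, hN⟩ := pow_unbounded_of_one_lt K hlt
  have h1 := h N
  have h2 : ‖M ^ (2 ^ N)‖ = ‖M‖ ^ (2 ^ N) := by
    have := hM.isSelfAdjoint.nnnorm_pow_two_pow N
    simpa using congrArg NNReal.toReal this
  rw [h2] at h1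
  have h3 : ‖M‖ ^ N ≤ ‖M‖ ^ (2 ^ N) := pow_le_pow_right₀ hlt.le Nat.lt_two_pow_self.le
  linarith

lemma inverse_eq_rpow {S : 𝒜} (hS : IsStrictlyPositive S) : Ring.inverse S = S ^ (-1 : ℝ) :=
  CFC.inverse_eq_rpow_neg_one hS

lemma conjPow_rpow_le_iff {X Y : 𝒜} (hX : IsStrictlyPositive X) (s : ℝ) :
    conjPow X (-s / 2) Y ≤ 1 ↔ Y ≤ X ^ s := by
  rw [conjPow_le_iff hX, ← rpow_zero_of_sp hX, conjPow_rpow hX]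
  congr! 2; ring

lemma one_le_conjPow_rpow_iff {X Y : 𝒜} (hX : IsStrictlyPositive X) (hY : IsStrictlyPositive Y)
    (s : ℝ) : conjPow X (-s / 2) Y ^ (-1 : ℝ) ≤ 1 ↔ X ^ s ≤ Y := by
  rw [← conjPow_inv hX _ hY, conjPow_rpow_le_iff (sp_rpow hX _), rpow_neg_one_rpow hX]
  exact ⟨le_of_rpow_neg_one_le (sp_rpow hX _) hY, rpow_neg_one_le (sp_rpow hX _)⟩

end CStar

/-! ### Operators read off from the chain; truncated indices make the bounds hold for every `j ≥ 1`.
-/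

section Sequences

variable {E : Type*} [NormedAddCommGroup E] [InnerProductSpace ℂ E] {A : ℕ → E →L[ℂ] E} {n : ℕ}

lemma sp_upSeq (hA : ∀ i ∈ Finset.Icc 1 (2 * n + 1), IsStrictlyPositive (A i)) {i : ℕ}
    (hi : 1 ≤ i) (j : ℕ) (hj : 1 ≤ j) : IsStrictlyPositive (upSeq A n i j) :=
  hA _ (by simp only [Finset.mem_Icc]; omega)

lemma sp_downSeq (hA : ∀ i ∈ Finset.Icc 1 (2 * n + 1), IsStrictlyPositive (A i)) {i : ℕ}
    (hi : i ≤ 2 * n) (j : ℕ) (hj : 1 ≤ j) : IsStrictlyPositive (downSeq A i j) :=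
  hA _ (by simp only [Finset.mem_Icc]; omega)

lemma le_of_chain (h : ∀ i ∈ Finset.Icc 1 (2 * n), A i ≤ A (i + 1)) {i j : ℕ} (hi : 1 ≤ i)
    (hij : i ≤ j) (hj : j ≤ 2 * n + 1) : A i ≤ A j := by
  induction j, hij using Nat.le_induction with
  | base => exact le_rfl
  | succ j hij ih => exact (ih (by omega)).trans (h j (by simp only [Finset.mem_Icc]; omega))

end Sequences

variable {H : Type*} [NormedAddCommGroup H] [InnerProductSpace ℂ H] [CompleteSpace H]

/-! ### The operator equations. -/

/-- The two products agree by associativity. Conjugating by `X ^ (r / 2)` turns the remaining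
equation into `Z ^ m = conjPow X (r / 2) N` with `Z = conjPow X ((r - s) / 2) T`, and positive roots
are unique. -/
lemma doubleEquality_iff {X T N : H →L[ℂ] H} (hX : IsStrictlyPositive X)
    (hT : IsStrictlyPositive T) (hN : IsStrictlyPositive N) {s r : ℝ} {m : ℕ} (hm : 2 ≤ m) :
    DoubleEquality X T N s r m ↔
      T = conjPow X (-(r - s) / 2) (conjPow X (r / 2) N ^ (1 / (m : ℝ))) := by
  obtain ⟨k, rfl⟩ : ∃ k, m = k + 1 := ⟨m - 1, by omega⟩
  have hcomm : T * (X ^ (r - s) * T) ^ k = (T * X ^ (r - s)) ^ k * T :=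
    (SemiconjBy.pow_right (show SemiconjBy T (X ^ (r - s) * T) (T * X ^ (r - s)) by
      simp [SemiconjBy, mul_assoc]) k)
  have h1 : DoubleEquality X T N s r (k + 1) ↔
      conjPow X (-s / 2) ((T * X ^ (r - s)) ^ k * T) = N := by
    rw [DoubleEquality, Nat.add_sub_cancel, mul_assoc (X ^ (-s / 2)) T, hcomm]
    simp [conjPow, mul_assoc]
  have hp := conjPow_pow_succ hX ((r - s) / 2) T k
  rw [show 2 * ((r - s) / 2) = r - s by ring] at hp
  have hZ := sp_conjPow hX ((r - s) / 2) hT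
  have h2 : conjPow X (-s / 2) ((T * X ^ (r - s)) ^ k * T) = N ↔
      conjPow X ((r - s) / 2) T ^ (k + 1) = conjPow X (r / 2) N := by
    rw [hp]
    constructor
    · rintro rfl
      rw [conjPow_conjPow hX]; congr 1; ring
    · intro h
      have := congrArg (conjPow X (-r / 2)) h
      rw [conjPow_conjPow hX, conjPow_cancel hX (by ring)] at this
      rw [← this]; congr 1; ring
  rw [h1, h2, pow_eq_iff_eq_rpow hZ (sp_conjPow hX _ hN) (by omega)]
  constructor
  · intro h
    rw [← h, conjPow_cancel hX (by ring)]
  · intro h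
    rw [h, conjPow_cancel hX (by ring)]

/-- The only candidate for `S` is explicit and strictly positive, so only its norm bound is at
stake. -/
lemma existsUnique_doubleEquality_iff {X N : H →L[ℂ] H} (hX : IsStrictlyPositive X)
    (hN : IsStrictlyPositive N) {s r : ℝ} {m : ℕ} (hm : 2 ≤ m) :
    (∃! S : H →L[ℂ] H, IsStrictlyPositive S ∧ ‖S‖ ≤ 1 ∧ DoubleEquality X S N s r m) ↔
      conjPow X (r / 2) N ^ (1 / (m : ℝ)) ≤ X ^ (r - s) := by
  have hY := sp_rpow (sp_conjPow hX (r / 2) hN) (1 / (m : ℝ))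
  have hT := sp_conjPow hX (-(r - s) / 2) hY
  rw [← conjPow_rpow_le_iff hX, ← CStarAlgebra.norm_le_one_iff_of_nonneg _ hT.nonneg]
  constructor
  · rintro ⟨S, ⟨hS, hS1, hE⟩, -⟩
    rwa [← (doubleEquality_iff hX hS hN hm).1 hE]
  · intro h
    refine ⟨_, ⟨hT, h, (doubleEquality_iff hX hT hN hm).2 rfl⟩, ?_⟩
    rintro S ⟨hS, -, hE⟩
    exact (doubleEquality_iff hX hS hN hm).1 hE

lemma existsUnique_doubleEquality_inverse_iff {X N : H →L[ℂ] H} (hX : IsStrictlyPositive X)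
    (hN : IsStrictlyPositive N) {s r : ℝ} {m : ℕ} (hm : 2 ≤ m) :
    (∃! S : H →L[ℂ] H, IsStrictlyPositive S ∧ ‖S‖ ≤ 1 ∧
        DoubleEquality X (Ring.inverse S) N s r m) ↔
      X ^ (r - s) ≤ conjPow X (r / 2) N ^ (1 / (m : ℝ)) := by
  have hY := sp_rpow (sp_conjPow hX (r / 2) hN) (1 / (m : ℝ))
  have hT := sp_conjPow hX (-(r - s) / 2) hY
  have hT' := sp_rpow hT (-1)
  have key {S : H →L[ℂ] H} (hS : IsStrictlyPositive S)
      (hE : DoubleEquality X (Ring.inverse S) N s r m) :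
      S = conjPow X (-(r - s) / 2) (conjPow X (r / 2) N ^ (1 / (m : ℝ))) ^ (-1 : ℝ) := by
    rw [inverse_eq_rpow hS, doubleEquality_iff hX (sp_rpow hS _) hN hm] at hE
    rw [← hE, rpow_rpow_cancel hS (by norm_num)]
  rw [← one_le_conjPow_rpow_iff hX hY, ← CStarAlgebra.norm_le_one_iff_of_nonneg _ hT'.nonneg]
  constructor
  · rintro ⟨S, ⟨hS, hS1, hE⟩, -⟩
    rwa [← key hS hE]
  · intro h
    refine ⟨_, ⟨hT', h, ?_⟩, ?_⟩
    · rw [inverse_eq_rpow hT', rpow_rpow_cancel hT (by norm_num),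
        doubleEquality_iff hX hT hN hm]
    · rintro S ⟨hS, -, hE⟩
      exact key hS hE

/-! ### The nested bracket and the extended grand Furuta inequality. -/

lemma nested_one (B : ℕ → H →L[ℂ] H) (t p : ℕ → ℝ) :
    nested B t p 1 = conjPow (B 2) (-(t 1) / 2) (B 1 ^ p 1) ^ p 2 := rfl

lemma nested_add_two (B : ℕ → H →L[ℂ] H) (t p : ℕ → ℝ) (k : ℕ) :
    nested B t p (k + 2) =
      conjPow (B (2 * k + 4)) (-(t (k + 2)) / 2)
        (conjPow (B (2 * k + 3)) (t (k + 1) / 2) (nested B t p (k + 1)) ^ p (2 * k + 3)) ^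
        p (2 * k + 4) := rfl

lemma sp_nested {B : ℕ → H →L[ℂ] H} (hB : ∀ j, 1 ≤ j → IsStrictlyPositive (B j)) (t p : ℕ → ℝ)
    (k : ℕ) : IsStrictlyPositive (nested B t p (k + 1)) := by
  induction k with
  | zero => exact sp_rpow (sp_conjPow (hB 2 (by omega)) _ (sp_rpow (hB 1 le_rfl) _)) _
  | succ k ih =>
    rw [nested_add_two]
    exact sp_rpow (sp_conjPow (hB _ (by omega)) _
      (sp_rpow (sp_conjPow (hB _ (by omega)) _ ih) _)) _

lemma nested_inv {B : ℕ → H →L[ℂ] H} (hB : ∀ j, 1 ≤ j → IsStrictlyPositive (B j)) (t p : ℕ → ℝ)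
    (k : ℕ) : nested (fun j => B j ^ (-1 : ℝ)) t p (k + 1) =
      nested B t p (k + 1) ^ (-1 : ℝ) := by
  induction k with
  | zero =>
    have h1 := hB 1 le_rfl
    have h2 := hB 2 (by omega)
    rw [nested_one, nested_one, rpow_neg_one_rpow h1, conjPow_inv h2 _ (sp_rpow h1 _),
      rpow_neg_one_rpow (sp_conjPow h2 _ (sp_rpow h1 _))]
  | succ k ih =>
    have h3 := hB (2 * k + 3) (by omega)
    have h4 := hB (2 * k + 4) (by omega)
    have hN := sp_nested hB t p k
    have h5 := sp_conjPow h3 (t (k + 1) / 2) hN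
    rw [nested_add_two, nested_add_two, ih, conjPow_inv h3 _ hN, rpow_neg_one_rpow h5,
      conjPow_inv h4 _ (sp_rpow h5 _), rpow_neg_one_rpow (sp_conjPow h4 _ (sp_rpow h5 _))]

lemma one_le_psi {n : ℕ} {t p : ℕ → ℝ} (ht : ∀ j ∈ Finset.Icc 1 n, t j ∈ Set.Icc (0 : ℝ) 1)
    (hp : ∀ j ∈ Finset.Icc 1 (2 * n), 1 ≤ p j) (k : ℕ) (hk : k ≤ n) : 1 ≤ psi t p k := by
  induction k with
  | zero => exact le_rfl
  | succ k ih =>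
    have h1 := ih (by omega)
    have h2 := hp (2 * k + 1) (by simp; omega)
    have h3 := hp (2 * k + 2) (by simp; omega)
    obtain ⟨h4, h5⟩ := ht (k + 1) (by simp; omega)
    have h6 : 1 ≤ psi t p k * p (2 * k + 1) := one_le_mul_of_one_le_of_one_le h1 h2
    rw [psi]
    nlinarith

/-- The extended grand Furuta inequality with outer exponent `t k`. -/
lemma nested_rpow_le {n : ℕ} {t p : ℕ → ℝ} (ht : ∀ j ∈ Finset.Icc 1 n, t j ∈ Set.Icc (0 : ℝ) 1)
    (hp : ∀ j ∈ Finset.Icc 1 (2 * n), 1 ≤ p j) {B : ℕ → H →L[ℂ] H}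
    (hB : ∀ j, 1 ≤ j → IsStrictlyPositive (B j)) (hmono : ∀ j, 1 ≤ j → B j ≤ B (j + 1))
    (k : ℕ) (hk : k + 1 ≤ n) : ∀ C : H →L[ℂ] H, B (2 * k + 2) ≤ C →
      conjPow C (t (k + 1) / 2) (nested B t p (k + 1)) ^ (1 / psi t p (k + 1)) ≤ C := by
  induction k with
  | zero =>
    intro C hC
    obtain ⟨h4, h5⟩ := ht 1 (by simp; omega)
    have := grand_furuta_three h4 h5 (hp 1 (by simp; omega)) (hp 2 (by simp; omega))
      (hB 1 le_rfl) (hmono 1 le_rfl) hC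
    simpa [nested_one, psi] using this
  | succ k ih =>
    intro C hC
    obtain ⟨h4, h5⟩ := ht (k + 2) (by simp; omega)
    have hψ := one_le_psi ht hp (k + 1) (by omega)
    have h2 := hp (2 * k + 3) (by simp; omega)
    have h3 := hp (2 * k + 4) (by simp; omega)
    -- Leaving `C` free in the induction allows closing the inner bracket with `B (2 * k + 3)`. Its
    -- root of order `psi t p (k + 1)` is the `y` of the three-operator inequality.
    have hy := ih (by omega) (B (2 * k + 3)) (hmono _ (by omega))
    have hsp := sp_conjPow (hB (2 * k + 3) (by omega)) (t (k + 1) / 2) (sp_nested hB t p k)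
    have := grand_furuta_three h4 h5 (one_le_mul_of_one_le_of_one_le hψ h2) h3 (sp_rpow hsp _)
      (hy.trans (hmono _ (by omega))) hC
    rw [rpow_rpow_of_sp hsp, show 1 / psi t p (k + 1) * (psi t p (k + 1) * p (2 * k + 3)) =
      p (2 * k + 3) by field_simp] at this
    exact this

/-- Furuta's inequality with `u = r - t (n + 1)` and exponent `ψ` raises the outer exponent to `r`;
the admissibility equation says `u / (ψ + u) = 1 / m`. -/
lemma conjPow_nested_rpow_le {n : ℕ} {t p : ℕ → ℝ} {r : ℝ} {m : ℕ}
    (h : Admissible (n + 1) t p r m) {B : ℕ → H →L[ℂ] H} {X : H →L[ℂ] H}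
    (hB : ∀ j, 1 ≤ j → IsStrictlyPositive (B j)) (hmono : ∀ j, 1 ≤ j → B j ≤ B (j + 1))
    (hX : ∀ j, 1 ≤ j → B j ≤ X) :
    conjPow X (r / 2) (nested B t p (n + 1)) ^ (1 / (m : ℝ)) ≤ X ^ (r - t (n + 1)) := by
  have hm : (0 : ℝ) < m := by have := h.two_le_m; positivity
  have hXp := (hB 1 le_rfl).of_le (hX 1 le_rfl)
  have hψ := one_le_psi h.t_mem h.one_le_p (n + 1) le_rfl
  have hz := nested_rpow_le h.t_mem h.one_le_p hB hmono n le_rfl X (hX _ (by omega))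
  have hsp := sp_conjPow hXp (t (n + 1) / 2) (sp_nested hB t p n)
  have hu : 0 ≤ r - t (n + 1) := sub_nonneg.2 h.t_le_r
  have := furuta_chaotic (sp_rpow hsp _) hz hψ hu
  rw [rpow_rpow_cancel hsp (by field_simp), conjPow_conjPow hXp] at this
  have he := h.exponent_eq
  have hden : 0 < psi t p (n + 1) + (r - t (n + 1)) := by linarith
  have hE : (r - t (n + 1)) / (psi t p (n + 1) + (r - t (n + 1))) = 1 / (m : ℝ) := by
    rw [div_eq_div_iff hden.ne' hm.ne']; linarith
  rwa [hE, show (r - t (n + 1)) / 2 + t (n + 1) / 2 = r / 2 by ring] at this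

lemma conjPow_nested_inv {B : ℕ → H →L[ℂ] H} {X : H →L[ℂ] H}
    (hB : ∀ j, 1 ≤ j → IsStrictlyPositive (B j)) (hX : IsStrictlyPositive X) (t p : ℕ → ℝ)
    (n : ℕ) (x y : ℝ) :
    conjPow (X ^ (-1 : ℝ)) x (nested (fun j => B j ^ (-1 : ℝ)) t p (n + 1)) ^ y =
      (conjPow X x (nested B t p (n + 1)) ^ y) ^ (-1 : ℝ) := by
  have hN := sp_nested hB t p n
  rw [nested_inv hB, conjPow_inv hX _ hN, rpow_neg_one_rpow (sp_conjPow hX _ hN)]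

lemma le_conjPow_nested_rpow {n : ℕ} {t p : ℕ → ℝ} {r : ℝ} {m : ℕ}
    (h : Admissible (n + 1) t p r m) {B : ℕ → H →L[ℂ] H} {X : H →L[ℂ] H}
    (hB : ∀ j, 1 ≤ j → IsStrictlyPositive (B j)) (hanti : ∀ j, 1 ≤ j → B (j + 1) ≤ B j)
    (hXp : IsStrictlyPositive X) (hX : ∀ j, 1 ≤ j → X ≤ B j) :
    X ^ (r - t (n + 1)) ≤ conjPow X (r / 2) (nested B t p (n + 1)) ^ (1 / (m : ℝ)) := by
  have := conjPow_nested_rpow_le h (B := fun j => B j ^ (-1 : ℝ)) (X := X ^ (-1 : ℝ))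
    (fun j hj => sp_rpow (hB j hj) _)
    (fun j hj => rpow_neg_one_le (hB _ (by omega)) (hanti j hj))
    (fun j hj => rpow_neg_one_le hXp (hX j hj))
  rw [conjPow_nested_inv hB hXp, rpow_neg_one_rpow hXp] at this
  exact le_of_rpow_neg_one_le (sp_rpow hXp _)
    (sp_rpow (sp_conjPow hXp _ (sp_nested hB t p n)) _) this

/-! ### Recovering the order from test parameters. -/

/-- Exponents equal to one, except for the second one, which is `2 ^ q`. -/
def testExponents (q : ℕ) : ℕ → ℝ := fun j => if j = 2 then 2 ^ q else 1

/-- The factor `p 1 - t 1` in front of `p 2` vanishes, so `q` can grow while `r` and `m` stay fixed.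
-/
lemma psi_test (q k : ℕ) : psi (fun _ => 1) (testExponents q) k = 1 := by
  induction k with
  | zero => rfl
  | succ k ih => rw [psi, ih]; simp [testExponents]

lemma admissible_test (q n : ℕ) : Admissible n (fun _ => 1) (testExponents q) 2 2 where
  t_mem := by simp
  one_le_p j _ := by
    rw [testExponents]
    split_ifs
    · exact one_le_pow₀ one_le_two
    · exact le_rfl
  t_le_r := one_le_two
  two_le_m := le_rfl
  exponent_eq := by rw [psi_test]; norm_num

lemma exists_isUnit_nested_test {B : ℕ → H →L[ℂ] H}
    (hB : ∀ j, 1 ≤ j → IsStrictlyPositive (B j)) (k : ℕ) :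
    ∃ W : H →L[ℂ] H, IsUnit W ∧ ∀ q : ℕ, nested B (fun _ => 1) (testExponents q) (k + 1) =
      W * conjPow (B 2) (-1 / 2) (B 1) ^ (2 ^ q) * star W := by
  induction k with
  | zero =>
    refine ⟨1, isUnit_one, fun q => ?_⟩
    have h1 := hB 1 le_rfl
    have hM := sp_conjPow (hB 2 (by omega)) (-1 / 2) h1
    rw [nested_one, ← CFC.rpow_natCast _ _ hM.nonneg]
    simp [testExponents, rpow_one_of_sp h1]
  | succ k ih =>
    obtain ⟨W, hW, h⟩ := ih
    have h3 := hB (2 * k + 3) (by omega)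
    have h4 := hB (2 * k + 4) (by omega)
    refine ⟨B (2 * k + 4) ^ (-1 / 2 : ℝ) * B (2 * k + 3) ^ (1 / 2 : ℝ) * W,
      ((sp_rpow h4 _).isUnit.mul (sp_rpow h3 _).isUnit).mul hW, fun q => ?_⟩
    have hN := sp_nested hB (fun _ => 1) (testExponents q) k
    have h5 := sp_conjPow h3 (1 / 2) hN
    have e3 : testExponents q (2 * k + 3) = 1 := by simp [testExponents]
    have e4 : testExponents q (2 * k + 4) = 1 := by simp [testExponents]
    rw [nested_add_two, e3, e4, rpow_one_of_sp h5, rpow_one_of_sp (sp_conjPow h4 _ h5), h q,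
      star_mul, star_mul, (sp_rpow h4 _).isSelfAdjoint.star_eq,
      (sp_rpow h3 _).isSelfAdjoint.star_eq]
    simp only [conjPow, mul_assoc]

lemma le_of_forall_test {n : ℕ} {B : ℕ → H →L[ℂ] H} {X : H →L[ℂ] H}
    (hB : ∀ j, 1 ≤ j → IsStrictlyPositive (B j)) (hX : IsStrictlyPositive X)
    (h : ∀ q, conjPow X (2 / 2) (nested B (fun _ => 1) (testExponents q) (n + 1)) ^
      (1 / ((2 : ℕ) : ℝ)) ≤ X ^ (2 - 1 : ℝ)) : B 1 ≤ B 2 := by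
  obtain ⟨W, hW, hn⟩ := exists_isUnit_nested_test hB n
  have h2 := hB 2 (by omega)
  have hM := sp_conjPow h2 (-1 / 2) (hB 1 le_rfl)
  set M := conjPow (B 2) (-1 / 2) (B 1)
  suffices hM1 : M ≤ 1 by
    have := (conjPow_rpow_le_iff h2 1).1 hM1
    rwa [rpow_one_of_sp h2] at this
  obtain ⟨V, hV⟩ := (sp_rpow hX (2 / 2)).isUnit.mul hW
  -- `M ^ (2 ^ q) = V⁻¹ * Y * star V⁻¹`, and the hypothesis says that the square root of `Y` is at
  -- most `X`, so `‖Y‖ ≤ ‖X‖ * ‖X‖`.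
  refine le_one_of_forall_norm_pow_le hM (K := ‖(↑V⁻¹ : H →L[ℂ] H)‖ * (‖X‖ * ‖X‖) *
    ‖star (↑V⁻¹ : H →L[ℂ] H)‖) fun q => ?_
  set Y := conjPow X (2 / 2) (nested B (fun _ => 1) (testExponents q) (n + 1)) with hY
  have hYp : IsStrictlyPositive Y := sp_conjPow hX _ (sp_nested hB _ _ _)
  have hYV : Y = V * M ^ (2 ^ q) * star (V : H →L[ℂ] H) := by
    rw [hY, hn q, hV, star_mul, (sp_rpow hX _).isSelfAdjoint.star_eq]
    simp only [conjPow, mul_assoc]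
  have hVV : star (V : H →L[ℂ] H) * star (↑V⁻¹ : H →L[ℂ] H) = 1 := by
    rw [← star_mul]; simp
  have hMY : M ^ (2 ^ q) = ↑V⁻¹ * Y * star (↑V⁻¹ : H →L[ℂ] H) := by
    rw [hYV]
    simp only [mul_assoc]
    rw [hVV, mul_one, Units.inv_mul_cancel_left]
  have hZ := h q
  rw [show (2 - 1 : ℝ) = 1 by norm_num, rpow_one_of_sp hX] at hZ
  have hZn := CStarAlgebra.norm_le_norm_of_nonneg_of_le (sp_rpow hYp _).nonneg hZ
  have hYZ : Y = Y ^ (1 / ((2 : ℕ) : ℝ)) * Y ^ (1 / ((2 : ℕ) : ℝ)) := by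
    rw [rpow_mul_rpow hYp]; norm_num; exact (rpow_one_of_sp hYp).symm
  have hYn : ‖Y‖ ≤ ‖X‖ * ‖X‖ := by
    rw [hYZ]
    exact (norm_mul_le _ _).trans (mul_le_mul hZn hZn (norm_nonneg _) (norm_nonneg _))
  rw [hMY]
  refine (norm_mul_le _ _).trans ?_
  gcongr
  refine (norm_mul_le _ _).trans ?_
  gcongr

lemma ge_of_forall_test {n : ℕ} {B : ℕ → H →L[ℂ] H} {X : H →L[ℂ] H}
    (hB : ∀ j, 1 ≤ j → IsStrictlyPositive (B j)) (hX : IsStrictlyPositive X)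
    (h : ∀ q, X ^ (2 - 1 : ℝ) ≤ conjPow X (2 / 2)
      (nested B (fun _ => 1) (testExponents q) (n + 1)) ^ (1 / ((2 : ℕ) : ℝ))) : B 2 ≤ B 1 := by
  refine le_of_rpow_neg_one_le (hB 2 (by omega)) (hB 1 le_rfl) ?_
  refine le_of_forall_test (n := n) (B := fun j => B j ^ (-1 : ℝ)) (X := X ^ (-1 : ℝ))
    (fun j hj => sp_rpow (hB j hj) _) (sp_rpow hX _) fun q => ?_
  rw [conjPow_nested_inv hB hX, rpow_neg_one_rpow hX]
  exact rpow_neg_one_le (sp_rpow hX _) (h q)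

/-! ### Assembly of the equivalences. -/

lemma inequality_of_chain {n : ℕ} {A : ℕ → H →L[ℂ] H}
    (hA : ∀ i ∈ Finset.Icc 1 (2 * (n + 1) + 1), IsStrictlyPositive (A i))
    (h : ∀ i ∈ Finset.Icc 1 (2 * (n + 1)), A i ≤ A (i + 1)) {t p : ℕ → ℝ} {r : ℝ} {m : ℕ}
    (hadm : Admissible (n + 1) t p r m) {i : ℕ} (hi : i ∈ Finset.Icc 1 (2 * (n + 1))) :
    Inequality A (n + 1) t p r m i := by
  rw [Finset.mem_Icc] at hi
  unfold Inequality
  split_ifs with hin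
  · exact conjPow_nested_rpow_le hadm (sp_upSeq hA hi.1)
      (fun j hj => le_of_chain h (by omega) (by omega) (by omega))
      (fun j hj => le_of_chain h (by omega) (by omega) (by omega))
  · exact le_conjPow_nested_rpow hadm (sp_downSeq hA hi.2)
      (fun j hj => le_of_chain h (by omega) (by omega) (by omega))
      (hA 1 (by simp))
      (fun j hj => le_of_chain h (by omega) (by omega) (by omega))

/-- The test compares only the first two operators of each sequence: `A i`, `A (i + 1)` going up,
and the same pair reversed going down. -/
lemma le_succ_of_forall_inequality {n : ℕ} {A : ℕ → H →L[ℂ] H}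
    (hA : ∀ i ∈ Finset.Icc 1 (2 * (n + 1) + 1), IsStrictlyPositive (A i)) {i : ℕ}
    (hi : i ∈ Finset.Icc 1 (2 * (n + 1)))
    (h : ∀ q, Inequality A (n + 1) (fun _ => 1) (testExponents q) 2 2 i) : A i ≤ A (i + 1) := by
  rw [Finset.mem_Icc] at hi
  by_cases hin : i ≤ n + 1
  · have := le_of_forall_test (n := n) (sp_upSeq hA hi.1) (hA (2 * (n + 1) + 1) (by simp))
      fun q => by
        have h' := h q
        rw [Inequality, if_pos hin] at h'
        exact h'
    rwa [upSeq, upSeq, show min (i + 1 - 1) (2 * (n + 1) + 1) = i by omega,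
      show min (i + 2 - 1) (2 * (n + 1) + 1) = i + 1 by omega] at this
  · have := ge_of_forall_test (n := n) (sp_downSeq hA hi.2) (hA 1 (by simp))
      fun q => by
        have h' := h q
        rw [Inequality, if_neg hin] at h'
        exact h'
    rwa [downSeq, downSeq, show max (i + 2 - 1) 1 = i + 1 by omega,
      show max (i + 2 - 2) 1 = i by omega] at this

lemma inequality_iff_uniqueSolution {n : ℕ} {A : ℕ → H →L[ℂ] H}
    (hA : ∀ i ∈ Finset.Icc 1 (2 * (n + 1) + 1), IsStrictlyPositive (A i)) {t p : ℕ → ℝ} {r : ℝ}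
    {m : ℕ} (hm : 2 ≤ m) {i : ℕ} (hi : i ∈ Finset.Icc 1 (2 * (n + 1))) :
    Inequality A (n + 1) t p r m i ↔ UniqueSolution A (n + 1) t p r m i := by
  rw [Finset.mem_Icc] at hi
  unfold Inequality UniqueSolution Equality
  split_ifs with hin
  · exact (existsUnique_doubleEquality_iff (hA _ (by simp)) (sp_nested (sp_upSeq hA hi.1) t p n)
      hm).symm
  · exact (existsUnique_doubleEquality_inverse_iff (hA 1 (by simp))
      (sp_nested (sp_downSeq hA hi.2) t p n) hm).symm

end OperatorOrder

end

theorem theorem3p1 {H : Type*} [NormedAddCommGroup H] [InnerProductSpace ℂ H] [CompleteSpace H]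
    (n : ℕ) (hn : 1 ≤ n) (A : ℕ → H →L[ℂ] H)
    (hA : ∀ i ∈ Finset.Icc 1 (2 * n + 1), IsStrictlyPositive (A i)) :
    List.TFAE
      [ ∀ i ∈ Finset.Icc 1 (2 * n), A i ≤ A (i + 1),
        ∀ (t p : ℕ → ℝ) (r : ℝ) (m : ℕ), OperatorOrder.Admissible n t p r m →
          ∀ i ∈ Finset.Icc 1 (2 * n), OperatorOrder.Inequality A n t p r m i,
        ∀ (t p : ℕ → ℝ) (r : ℝ) (m : ℕ), OperatorOrder.Admissible n t p r m →
          ∀ i ∈ Finset.Icc 1 (2 * n), OperatorOrder.UniqueSolution A n t p r m i ] ∧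
    ∀ (t p : ℕ → ℝ) (r : ℝ) (m : ℕ), OperatorOrder.Admissible n t p r m →
      ∀ i ∈ Finset.Icc 1 (2 * n),
        (OperatorOrder.Inequality A n t p r m i ↔ OperatorOrder.UniqueSolution A n t p r m i) := by
  -- Avoids the irrelevant value of `nested` at `0`.
  obtain ⟨n, rfl⟩ : ∃ k, n = k + 1 := ⟨n - 1, by omega⟩
  have hiff : ∀ (t p : ℕ → ℝ) (r : ℝ) (m : ℕ), OperatorOrder.Admissible (n + 1) t p r m →
      ∀ i ∈ Finset.Icc 1 (2 * (n + 1)), (OperatorOrder.Inequality A (n + 1) t p r m i ↔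
        OperatorOrder.UniqueSolution A (n + 1) t p r m i) := fun t p r m h i hi =>
    OperatorOrder.inequality_iff_uniqueSolution hA h.two_le_m hi
  refine ⟨?_, hiff⟩
  tfae_have 1 → 2 := fun h t p r m hadm i hi => OperatorOrder.inequality_of_chain hA h hadm hi
  tfae_have 2 → 1 := fun h i hi => OperatorOrder.le_succ_of_forall_inequality hA hi fun q =>
    h _ _ _ _ (OperatorOrder.admissible_test q (n + 1)) i hi
  tfae_have 2 → 3 := fun h t p r m hadm i hi => (hiff t p r m hadm i hi).1 (h t p r m hadm i hi)
  tfae_have 3 → 2 := fun h t p r m hadm i hi => (hiff t p r m hadm i hi).2 (h t p r m hadm i hi)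
  tfae_finish
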